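/- Let $m\ge 1$ and $N\ge 0$ be integers and let $U_1(z)=[u_{1}(z),\dots,u_{m}(z)]$, $u_{j}(z)=\sum_{n=0}^N\alpha_{jn}z^n$ with $\alpha_{jn}\in\mathbb C$, be a polynomial row vector of length $N$, i.e. $\alpha_{jN}\neq 0$ for at least one $j$, which has unit norm on the unit circle: $\sum_{j=1}^m|u_{j}(z)|^2=1$ for all $z\in\mathbb C$ with $|z|=1$. Consider the $m\times m$ matrix polynomials $U(z)=\sum_{n=0}^N\rho_nz^n$, $\rho_n\in\mathbb C^{m\times m}$, with the following properties: (i) $U$ is paraunitary: $U(z)U^*(z)=I_m$ for all $z\in\mathbb C\setminus\{0\}$, where $U^*(z)=\overline{U(1/\overline z)}^{\,T}$; (ii) $U$ has length $N$, i.e. $\rho_N\ne 0$; (iii) $\det U(z)=c\,z^N$ for some constant $c\in\mathbb C$ with $|c|=1$; (iv) the first row of $U$ is $U_1$. Then such a $U$ exists, and it is unique up to a constant left multiplier of the block form $\begin{pmatrix}1&0\\0&V\end{pmatrix}$ with $V$ an $(m-1)\times(m-1)$ unitary matrix: if $U$ has properties (i)-(iv), then an $m\times m$ matrix polynomial $W$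 has them if and only if $W(z)=\begin{pmatrix}1&0\\0&V\end{pmatrix}U(z)$ for some unitary $V\in\mathbb C^{(m-1)\times(m-1)}$. -/

import Mathlib

open Polynomial

/-- The value `U(z)` of a matrix polynomial `U` at the complex number `z`. -/
noncomputable def matEval {m n : Type*} (U : Matrix m n ℂ[X]) (z : ℂ) : Matrix m n ℂ :=
  U.map (fun p => p.eval z)

/-- The matrix coefficient `ρ_n` of `z^n` in a matrix polynomial `U(z) = ∑ ρ_n z^n`. -/
noncomputable def matCoeff {m n : Type*} (U : Matrix m n ℂ[X]) (k : ℕ) : Matrix m n ℂ :=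
  U.map (fun p => p.coeff k)

/-- `U(z) = ∑_{n=0}^N ρ_n z^n` with `ρ_N ≠ 0`. -/
def HasLength {m n : Type*} (U : Matrix m n ℂ[X]) (N : ℕ) : Prop :=
  matCoeff U N ≠ 0 ∧ ∀ k, N < k → matCoeff U k = 0

/-- The adjoint matrix-function `U^*(z) = (conj (U (1 / conj z)))^T` (meaningful for `z ≠ 0`). -/
noncomputable def adjointFun {m n : Type*} (U : Matrix m n ℂ[X]) (z : ℂ) : Matrix n m ℂ :=
  (matEval U (1 / (starRingEnd ℂ z))).conjTranspose

/-- A square matrix polynomial is paraunitary if `U(z) U^*(z) = I` for all `z ≠ 0`. -/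
def IsParaunitary {n : Type*} [Fintype n] [DecidableEq n] (U : Matrix n n ℂ[X]) : Prop :=
  ∀ z : ℂ, z ≠ 0 → matEval U z * adjointFun U z = 1

/-- `U` is a paraunitary matrix polynomial of length `N`, with determinant `c z^N` for some
constant `c` of modulus one, whose first row is `u`. -/
def IsParaunitaryCompletion {k : ℕ} (u : Fin (k + 1) → ℂ[X]) (N : ℕ)
    (U : Matrix (Fin (k + 1)) (Fin (k + 1)) ℂ[X]) : Prop :=
  IsParaunitary U ∧ HasLength U N ∧ (∃ c : ℂ, ‖c‖ = 1 ∧ U.det = C c * X ^ N) ∧ U 0 = u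

/-- The block matrix `diag(1, V)`. -/
def blockDiagOne {k : ℕ} (V : Matrix (Fin k) (Fin k) ℂ) :
    Matrix (Fin (k + 1)) (Fin (k + 1)) ℂ :=
  Matrix.of (Fin.cons (Fin.cons 1 (fun _ => 0)) (fun i => Fin.cons 0 (V i)))

section

open scoped Matrix ComplexConjugate

variable {l m n : Type*}

/-! Induction on `N`. Let `a` be the leading coefficient of the row `u`, `P` the orthogonal
projection onto its span, and `F = (1 - P) + z P`, which is paraunitary with determinant `z`.
Comparing constant terms in `A · z^N A^* = z^N` makes the rows of `A(0)` orthogonal to those of the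
leading coefficient (`IsCircleIsometry.matCoeff_zero_mul`). Hence `F` divides on the right both `u`
and every completion of `u`, whose degree is bounded by its determinant
(`IsCircleIsometry.natDegree_le`). The quotient row has length one less, so completions of `u`
correspond to completions of a shorter row. At `N = 0` this is the extension of a unit vector to a
unitary matrix, unique up to `diag(1, V)`. As `F` depends on `u` alone, `V` survives the induction
unchanged. -/

lemma matEval_mul [Fintype m] (A : Matrix l m ℂ[X]) (B : Matrix m n ℂ[X]) (z : ℂ) :
    matEval (A * B) z = matEval A z * matEval B z := by
  ext i j
  simp [matEval, Matrix.mul_apply, eval_finsetSum]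

lemma matEval_map_C (A : Matrix m n ℂ) (z : ℂ) : matEval (A.map C) z = A := by
  ext i j
  simp [matEval]

lemma matCoeff_add (A B : Matrix m n ℂ[X]) (k : ℕ) :
    matCoeff (A + B) k = matCoeff A k + matCoeff B k := by
  ext i j
  simp [matCoeff]

lemma matCoeff_mul_map_C [Fintype m] (A : Matrix l m ℂ[X]) (P : Matrix m n ℂ) (k : ℕ) :
    matCoeff (A * P.map C) k = matCoeff A k * P := by
  ext i j
  simp [matCoeff, Matrix.mul_apply]

/-! ### Isometry on the circle as a polynomial identity -/

/-- The rows of `A` are orthonormal at every point of the unit circle. -/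
def IsCircleIsometry [Fintype n] [DecidableEq m] (A : Matrix m n ℂ[X]) : Prop :=
  ∀ z : ℂ, ‖z‖ = 1 → matEval A z * (matEval A z)ᴴ = 1

/-- The polynomial matrix `z^K A^*(z)`, for `A` of degree at most `K`. -/
noncomputable def starReflect (K : ℕ) (A : Matrix m n ℂ[X]) : Matrix n m ℂ[X] :=
  Aᵀ.map fun p => (p.map (starRingEnd ℂ)).reflect K

lemma coeff_starReflect (A : Matrix m n ℂ[X]) {k K : ℕ} (hk : k ≤ K) (i : n) (j : m) :
    (starReflect K A i j).coeff k = conj ((A j i).coeff (K - k)) := by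
  simp [starReflect, coeff_reflect, revAt_le hk]

lemma matEval_starReflect (A : Matrix m n ℂ[X]) {K : ℕ} (hA : ∀ i j, (A i j).natDegree ≤ K)
    {z : ℂ} (hz : z ≠ 0) : matEval (starReflect K A) z = z ^ K • adjointFun A z := by
  ext i j
  let _ : Invertible z⁻¹ := invertibleOfNonzero (inv_ne_zero hz)
  have h := eval₂_reflect_mul_pow (RingHom.id ℂ) z⁻¹ K ((A j i).map (starRingEnd ℂ))
    ((natDegree_map_le).trans (hA j i))
  have hz' : (⅟(z⁻¹) : ℂ) = z := by simp
  rw [hz', ← eval, ← eval, inv_pow] at h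
  have h2 : eval z⁻¹ ((A j i).map (starRingEnd ℂ)) = conj (eval (1 / conj z) (A j i)) := by
    rw [eval_map, ← Complex.conj_conj z⁻¹, eval₂_hom]
    simp
  have h3 : matEval (starReflect K A) z i j
      = eval z (reflect K ((A j i).map (starRingEnd ℂ))) := rfl
  have h4 : (z ^ K • adjointFun A z) i j = z ^ K * conj (eval (1 / conj z) (A j i)) := rfl
  rw [h3, h4, ← h2, ← h]
  field_simp

lemma infinite_circle : {z : ℂ | ‖z‖ = 1}.Infinite := by
  have h := (isPreconnected_sphere (E := ℂ) (by simp [Complex.rank_real_complex]) 0 1)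
  have := h.infinite_of_nontrivial ⟨1, by simp, -1, by simp, by norm_num⟩
  convert this using 1
  ext z
  simp

lemma adjointFun_of_norm_eq_one (A : Matrix m n ℂ[X]) {z : ℂ} (hz : ‖z‖ = 1) :
    adjointFun A z = (matEval A z)ᴴ := by
  have : 1 / conj z = z := by
    rw [one_div, ← Complex.inv_eq_conj hz, inv_inv]
  rw [adjointFun, this]

/-- Both sides are polynomial and agree on the infinite set `|z| = 1`, where `1 / conj z = z`. -/
lemma IsCircleIsometry.mul_starReflect [Fintype n] [DecidableEq m] {A : Matrix m n ℂ[X]}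
    (h : IsCircleIsometry A) {K : ℕ} (hA : ∀ i j, (A i j).natDegree ≤ K) :
    A * starReflect K A = (X ^ K : ℂ[X]) • (1 : Matrix m m ℂ[X]) := by
  ext1 i j
  refine eq_of_infinite_eval_eq _ _ (infinite_circle.mono fun z hz => ?_)
  have hz : ‖z‖ = 1 := hz
  have hz0 : z ≠ 0 := by rintro rfl; simp at hz
  have h1 : matEval (A * starReflect K A) z = z ^ K • 1 := by
    rw [matEval_mul, matEval_starReflect A hA hz0, adjointFun_of_norm_eq_one A hz,
      Matrix.mul_smul, h z hz]
  have h2 := congrFun (congrFun h1 i) j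
  simp only [matEval, Matrix.map_apply, Matrix.smul_apply] at h2
  rw [Set.mem_ofPred_eq, h2]
  by_cases hij : i = j <;> simp [Matrix.one_apply, hij]

lemma exists_natDegree_le [Finite m] [Finite n] (A : Matrix m n ℂ[X]) (N : ℕ) :
    ∃ K, N ≤ K ∧ ∀ i j, (A i j).natDegree ≤ K := by
  obtain ⟨K, hK⟩ := (Set.finite_range fun ij : m × n => (A ij.1 ij.2).natDegree).bddAbove
  exact ⟨max N K, le_max_left _ _, fun i j => (hK ⟨(i, j), rfl⟩).trans (le_max_right _ _)⟩

lemma isParaunitary_iff_isCircleIsometry [Fintype n] [DecidableEq n] {A : Matrix n n ℂ[X]} :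
    IsParaunitary A ↔ IsCircleIsometry A := by
  refine ⟨fun h z hz => ?_, fun h z hz => ?_⟩
  · rw [← adjointFun_of_norm_eq_one A hz]
    exact h z (by rintro rfl; simp at hz)
  · obtain ⟨K, -, hK⟩ := exists_natDegree_le A 0
    have h1 := congrArg (matEval · z) (h.mul_starReflect hK)
    have h2 : matEval ((X ^ K : ℂ[X]) • (1 : Matrix n n ℂ[X])) z = z ^ K • 1 := by
      ext i j
      by_cases hij : i = j <;> simp [matEval, hij]
    simp only [matEval_mul, matEval_starReflect A hK hz, h2, Matrix.mul_smul] at h1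
    exact smul_right_injective _ (pow_ne_zero K hz) h1

lemma IsCircleIsometry.matCoeff_zero_mul [Fintype n] [DecidableEq m] {A : Matrix m n ℂ[X]}
    (h : IsCircleIsometry A) {N : ℕ} (hN : N ≠ 0) (hA : ∀ i j, (A i j).natDegree ≤ N) :
    matCoeff A 0 * (matCoeff A N)ᴴ = 0 := by
  ext i j
  have h1 := congrArg (fun p => coeff p 0) (congrFun (congrFun (h.mul_starReflect hA) i) j)
  simp only [Matrix.mul_apply, finsetSum_coeff, mul_coeff_zero,
    coeff_starReflect A (Nat.zero_le N), Matrix.smul_apply, smul_eq_mul] at h1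
  simpa [Matrix.mul_apply, matCoeff, coeff_X_pow, hN.symm] using h1

/-- A paraunitary matrix with determinant `c z^N` has degree at most `N`. -/
lemma IsCircleIsometry.natDegree_le [Fintype n] [DecidableEq n] {U : Matrix n n ℂ[X]}
    (h : IsCircleIsometry U) {N : ℕ} {c : ℂ} (hc : ‖c‖ = 1) (hdet : U.det = C c * X ^ N)
    (i j : n) : (U i j).natDegree ≤ N := by
  have hc0 : c ≠ 0 := by rintro rfl; simp at hc
  obtain ⟨K, hNK, hK⟩ := exists_natDegree_le U N
  have h1 : U.det • starReflect K U = (X ^ K : ℂ[X]) • U.adjugate := by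
    have := congrArg (U.adjugate * ·) (h.mul_starReflect hK)
    simpa [← Matrix.mul_assoc, Matrix.adjugate_mul] using this
  -- Cancelling `z^N` shows that `z^(K-N)` divides `z^K U^*`; its coefficients below `K - N` are the
  -- conjugates of those of `U` above `N`.
  have h2 : C c * starReflect K U j i = X ^ (K - N) * U.adjugate j i := by
    have := congrFun (congrFun h1 j) i
    simp only [Matrix.smul_apply, smul_eq_mul, hdet] at this
    refine mul_left_cancel₀ (pow_ne_zero N X_ne_zero) ?_
    rw [← mul_assoc, ← mul_assoc, ← pow_add, Nat.add_sub_cancel' hNK, ← this]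
    ring
  refine natDegree_le_iff_coeff_eq_zero.2 fun k hk => ?_
  rcases le_or_gt k K with hkK | hkK
  · have h3 := congrArg (fun p => coeff p (K - k)) h2
    simp only [coeff_C_mul, coeff_starReflect U (Nat.sub_le K k), coeff_X_pow_mul',
      Nat.sub_sub_self hkK] at h3
    rw [if_neg (by omega)] at h3
    simpa [hc0] using h3
  · exact coeff_eq_zero_of_natDegree_lt ((hK i j).trans_lt hkK)

/-! ### Degree-one factors and division by them -/

/-- The elementary paraunitary factor `(1 - P) + z P`. -/
noncomputable def elementaryFactor [DecidableEq n] (P : Matrix n n ℂ) : Matrix n n ℂ[X] :=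
  (1 - P).map C + (X : ℂ[X]) • P.map C

lemma matEval_elementaryFactor [DecidableEq n] (P : Matrix n n ℂ) (z : ℂ) :
    matEval (elementaryFactor P) z = (1 - P) + z • P := by
  ext i j
  simp [matEval, elementaryFactor, mul_comm z]

lemma isCircleIsometry_elementaryFactor [Fintype n] [DecidableEq n] {P : Matrix n n ℂ}
    (hP : P * P = P) (hP' : Pᴴ = P) : IsCircleIsometry (elementaryFactor P) := by
  intro z hz
  have hz' : z * conj z = 1 := by
    rw [Complex.mul_conj, Complex.normSq_eq_norm_sq, hz]; simp
  simp only [matEval_elementaryFactor, Matrix.conjTranspose_add, Matrix.conjTranspose_sub,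
    Matrix.conjTranspose_smul, Matrix.conjTranspose_one, hP', add_mul, mul_add, sub_mul, mul_sub,
    Matrix.mul_smul, Matrix.smul_mul, hP, mul_one, one_mul, smul_smul, sub_self]
  have : conj z * z = 1 := by rw [mul_comm, hz']
  simp [this]

lemma isCircleIsometry_mul_iff [Fintype n] [DecidableEq n] [DecidableEq m]
    (A : Matrix m n ℂ[X]) {B : Matrix n n ℂ[X]} (hB : IsCircleIsometry B) :
    IsCircleIsometry (A * B) ↔ IsCircleIsometry A := by
  refine forall₂_congr fun z hz => ?_
  rw [matEval_mul, Matrix.conjTranspose_mul, Matrix.mul_assoc, ← Matrix.mul_assoc (matEval B z),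
    hB z hz, Matrix.one_mul]

/-- The quotient of `A` by `elementaryFactor P` on the right, when `A(0) P = 0`. -/
noncomputable def elementaryQuotient [Fintype n] [DecidableEq n] (P : Matrix n n ℂ)
    (A : Matrix m n ℂ[X]) : Matrix m n ℂ[X] :=
  A * (1 - P).map C + A.map divX * P.map C

lemma map_C_mul [Fintype m] (P : Matrix l m ℂ) (Q : Matrix m n ℂ) :
    P.map (C : ℂ → ℂ[X]) * Q.map C = (P * Q).map C :=
  (Matrix.map_mul (f := (C : ℂ →+* ℂ[X]))).symm

/-- The inverse of the factor is `(1 - P) + z⁻¹ P`, and `A P` is divisible by `z` because its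
constant term vanishes. -/
lemma elementaryQuotient_mul [Fintype n] [DecidableEq n] {P : Matrix n n ℂ} (hP : P * P = P)
    {A : Matrix m n ℂ[X]} (hA : matCoeff A 0 * P = 0) :
    elementaryQuotient P A * elementaryFactor P = A := by
  have h0 : A = (X : ℂ[X]) • A.map divX + (matCoeff A 0).map C := by
    ext1 i j
    simp [matCoeff]
  have h1 : (1 - P) * (1 - P) = 1 - P := by simp [mul_sub, sub_mul, hP]
  have h2 : (1 - P) * P = 0 := by simp [sub_mul, hP]
  have h3 : P * (1 - P) = 0 := by simp [mul_sub, hP]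
  have h4 : (1 - P).map (C : ℂ → ℂ[X]) = 1 - P.map C := by
    ext1 i j
    by_cases hij : i = j <;> simp [hij]
  have h5 : (X : ℂ[X]) • (A.map divX * P.map C) = A * P.map C := by
    conv_rhs => rw [h0, Matrix.add_mul, map_C_mul, hA]
    simp
  have h6 : (0 : Matrix n n ℂ).map (C : ℂ → ℂ[X]) = 0 := by ext1; simp
  rw [elementaryQuotient, elementaryFactor]
  simp only [Matrix.add_mul, Matrix.mul_add, Matrix.mul_smul, Matrix.mul_assoc, map_C_mul, h1, h2,
    h3, hP, h6, Matrix.mul_zero, add_zero, zero_add, h5]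
  rw [h4]
  simp [Matrix.mul_sub]

lemma matCoeff_elementaryQuotient [Fintype n] [DecidableEq n] (P : Matrix n n ℂ)
    (A : Matrix m n ℂ[X]) (k : ℕ) : matCoeff (elementaryQuotient P A) k =
      matCoeff A k * (1 - P) + matCoeff A (k + 1) * P := by
  rw [elementaryQuotient, matCoeff_add, matCoeff_mul_map_C, matCoeff_mul_map_C]
  congr 2
  ext i j
  simp [matCoeff]

/-- The orthogonal projection, acting on row vectors from the right, onto the span of `a`. -/
noncomputable def rowProjection [Fintype n] (a : n → ℂ) : Matrix n n ℂ :=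
  (star a ⬝ᵥ a)⁻¹ • Matrix.vecMulVec (star a) a

section rowProjection

variable [Fintype n] {a : n → ℂ}

lemma star_dotProduct_self_ne_zero (ha : a ≠ 0) : star a ⬝ᵥ a ≠ 0 := by
  open ComplexOrder in
  exact mt dotProduct_star_self_eq_zero.1 ha

lemma rowProjection_mul_self (ha : a ≠ 0) :
    rowProjection a * rowProjection a = rowProjection a := by
  have h := star_dotProduct_self_ne_zero ha
  rw [rowProjection, Matrix.smul_mul, Matrix.mul_smul, Matrix.vecMulVec_mul_vecMulVec,
    dotProduct_comm a, smul_smul]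
  ext i j
  simp [Matrix.vecMulVec_apply]
  field_simp

lemma conjTranspose_rowProjection : (rowProjection a)ᴴ = rowProjection a := by
  rw [rowProjection, Matrix.conjTranspose_smul, Matrix.conjTranspose_vecMulVec, star_star,
    star_inv₀, ← Matrix.star_dotProduct]

lemma vecMul_rowProjection (r : n → ℂ) :
    r ᵥ* rowProjection a = ((star a ⬝ᵥ a)⁻¹ * (r ⬝ᵥ star a)) • a := by
  rw [rowProjection, Matrix.vecMul_smul, Matrix.vecMul_vecMulVec, smul_smul]

lemma vecMul_rowProjection_self (ha : a ≠ 0) : a ᵥ* rowProjection a = a := by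
  have h := star_dotProduct_self_ne_zero ha
  rw [vecMul_rowProjection, dotProduct_comm a, inv_mul_cancel₀ h, one_smul]

/-- A rank-one perturbation of the identity: the determinant is `1 + (z - 1) tr P`, with `tr P = 1`.
-/
lemma det_elementaryFactor_rowProjection [DecidableEq n] (ha : a ≠ 0) :
    (elementaryFactor (rowProjection a)).det = X := by
  have h := star_dotProduct_self_ne_zero ha
  have h1 : elementaryFactor (rowProjection a) =
      1 + Matrix.replicateCol Unit (fun i => (X - 1) * C ((star a ⬝ᵥ a)⁻¹ * star a i)) *
        Matrix.replicateRow Unit (fun j => C (a j)) := by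
    ext1 i j
    by_cases hij : i = j <;>
      simp [elementaryFactor, rowProjection, Matrix.vecMulVec_apply, hij, Matrix.mul_apply] <;> ring
  rw [h1, Matrix.det_one_add_replicateCol_mul_replicateRow]
  have h2 : ∑ i, C (a i) * ((X - 1) * C ((star a ⬝ᵥ a)⁻¹ * star a i)) =
      (X - 1) * C ((star a ⬝ᵥ a)⁻¹ * (star a ⬝ᵥ a)) := by
    rw [dotProduct, Finset.mul_sum, map_sum, Finset.mul_sum]
    refine Finset.sum_congr rfl fun i _ => ?_
    simp only [map_mul]
    ring
  rw [dotProduct, h2, inv_mul_cancel₀ h]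
  simp

end rowProjection

lemma mul_rowProjection_eq_zero [Fintype n] {a : n → ℂ} (A : Matrix m n ℂ)
    (h : ∀ i, A i ⬝ᵥ star a = 0) : A * rowProjection a = 0 := by
  ext1 i j
  have : (A * rowProjection a) i = A i ᵥ* rowProjection a := Matrix.mul_apply_eq_vecMul _ _ _
  rw [this, vecMul_rowProjection, h]
  simp

end

/-! ### Completions and their descent in `N` -/

section

open scoped Matrix ComplexConjugate

variable {k : ℕ}

/-- Paraunitary completions of `u` with determinant `c z^N`, with no condition on the length. -/
def IsUnitaryCompletion (u : Fin (k + 1) → ℂ[X]) (N : ℕ)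
    (U : Matrix (Fin (k + 1)) (Fin (k + 1)) ℂ[X]) : Prop :=
  IsCircleIsometry U ∧ (∃ c : ℂ, ‖c‖ = 1 ∧ U.det = C c * X ^ N) ∧ U 0 = u

/-- The length condition is automatic: the first row gives `ρ_N ≠ 0`, the determinant gives the
degree bound. -/
lemma isParaunitaryCompletion_iff {u : Fin (k + 1) → ℂ[X]} {N : ℕ}
    (hlead : ∃ j, (u j).coeff N ≠ 0) {U : Matrix (Fin (k + 1)) (Fin (k + 1)) ℂ[X]} :
    IsParaunitaryCompletion u N U ↔ IsUnitaryCompletion u N U := by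
  rw [IsParaunitaryCompletion, isParaunitary_iff_isCircleIsometry]
  refine ⟨fun ⟨h1, _, h3⟩ => ⟨h1, h3⟩, fun ⟨h1, h3⟩ => ⟨h1, ⟨?_, fun n hn => ?_⟩, h3⟩⟩
  · obtain ⟨j, hj⟩ := hlead
    intro h
    have h' : (U 0 j).coeff N = 0 := congrFun (congrFun h 0) j
    rw [h3.2] at h'
    exact hj h'
  · obtain ⟨⟨c, hc, hdet⟩, -⟩ := h3
    ext i j
    exact coeff_eq_zero_of_natDegree_lt ((h1.natDegree_le hc hdet i j).trans_lt hn)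

lemma IsUnitaryCompletion.mul {u v : Fin (k + 1) → ℂ[X]} {N : ℕ} {a : Fin (k + 1) → ℂ}
    (ha : a ≠ 0) {U : Matrix (Fin (k + 1)) (Fin (k + 1)) ℂ[X]} (h : IsUnitaryCompletion u N U)
    (huv : v = u ᵥ* elementaryFactor (rowProjection a)) :
    IsUnitaryCompletion v (N + 1) (U * elementaryFactor (rowProjection a)) := by
  obtain ⟨h1, ⟨c, hc, hdet⟩, h3⟩ := h
  refine ⟨(isCircleIsometry_mul_iff _ (isCircleIsometry_elementaryFactor
    (rowProjection_mul_self ha) conjTranspose_rowProjection)).2 h1, ⟨c, hc, ?_⟩, ?_⟩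
  · rw [Matrix.det_mul, hdet, det_elementaryFactor_rowProjection ha]
    ring
  · rw [Matrix.mul_apply_eq_vecMul, h3, huv]

lemma IsUnitaryCompletion.elementaryQuotient {u : Fin (k + 1) → ℂ[X]} {N : ℕ}
    {U : Matrix (Fin (k + 1)) (Fin (k + 1)) ℂ[X]} (h : IsUnitaryCompletion u (N + 1) U)
    (ha : (fun j => (u j).coeff (N + 1)) ≠ 0) :
    let P := rowProjection fun j => (u j).coeff (N + 1)
    elementaryQuotient P U * elementaryFactor P = U ∧
      IsUnitaryCompletion (elementaryQuotient P (Matrix.replicateRow Unit u) ()) N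
        (elementaryQuotient P U) := by
  intro P
  obtain ⟨h1, ⟨c, hc, hdet⟩, h3⟩ := h
  have hP : P * P = P := rowProjection_mul_self ha
  have h4 : matCoeff U 0 * P = 0 := by
    refine mul_rowProjection_eq_zero _ fun i => ?_
    -- Column `0` suffices: row `0` of the leading coefficient of `U` is that of `u`.
    have := congrFun (congrFun (h1.matCoeff_zero_mul N.succ_ne_zero
      (h1.natDegree_le hc hdet)) i) 0
    simpa [Matrix.mul_apply, matCoeff, dotProduct, h3] using this
  have h5 := elementaryQuotient_mul hP h4
  refine ⟨h5, ?_, ⟨c, hc, ?_⟩, ?_⟩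
  · rwa [← isCircleIsometry_mul_iff _
      (isCircleIsometry_elementaryFactor hP conjTranspose_rowProjection), h5]
  · have h6 : (_root_.elementaryQuotient P U).det * X = C c * X ^ N * X := by
      rw [← det_elementaryFactor_rowProjection ha, ← Matrix.det_mul]
      change (_root_.elementaryQuotient P U * elementaryFactor P).det = _
      rw [h5, hdet, det_elementaryFactor_rowProjection ha]
      ring
    exact mul_right_cancel₀ X_ne_zero h6
  · ext1 j
    simp [_root_.elementaryQuotient, Matrix.mul_apply, h3]

/-! ### Constant block matrices and uniqueness -/

lemma blockDiagOne_mul (V W : Matrix (Fin k) (Fin k) ℂ) :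
    blockDiagOne V * blockDiagOne W = blockDiagOne (V * W) := by
  ext i j
  refine Fin.cases ?_ (fun i => ?_) i <;> refine Fin.cases ?_ (fun j => ?_) j <;>
    simp [blockDiagOne, Matrix.mul_apply, Fin.sum_univ_succ]

lemma conjTranspose_blockDiagOne (V : Matrix (Fin k) (Fin k) ℂ) :
    (blockDiagOne V)ᴴ = blockDiagOne Vᴴ := by
  ext i j
  refine Fin.cases ?_ (fun i => ?_) i <;> refine Fin.cases ?_ (fun j => ?_) j <;>
    simp [blockDiagOne]

lemma blockDiagOne_one : blockDiagOne (1 : Matrix (Fin k) (Fin k) ℂ) = 1 := by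
  ext i j
  refine Fin.cases ?_ (fun i => ?_) i <;> refine Fin.cases ?_ (fun j => ?_) j <;>
    simp [blockDiagOne, Matrix.one_apply, Fin.succ_ne_zero, (Fin.succ_ne_zero _).symm]

lemma blockDiagOne_injective : Function.Injective (blockDiagOne (k := k)) := by
  intro V W h
  ext i j
  simpa [blockDiagOne] using congrFun (congrFun h i.succ) j.succ

lemma blockDiagOne_mem_unitaryGroup_iff {V : Matrix (Fin k) (Fin k) ℂ} :
    blockDiagOne V ∈ Matrix.unitaryGroup (Fin (k + 1)) ℂ ↔ V ∈ Matrix.unitaryGroup (Fin k) ℂ := by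
  rw [Matrix.mem_unitaryGroup_iff, Matrix.mem_unitaryGroup_iff, Matrix.star_eq_conjTranspose,
    Matrix.star_eq_conjTranspose, conjTranspose_blockDiagOne, blockDiagOne_mul,
    ← blockDiagOne_one, blockDiagOne_injective.eq_iff]

/-- A unitary matrix whose first row is `e₀` has the form `diag(1, V)`. -/
lemma exists_eq_blockDiagOne {Q : Matrix (Fin (k + 1)) (Fin (k + 1)) ℂ}
    (hQ : Q ∈ Matrix.unitaryGroup (Fin (k + 1)) ℂ)
    (h0 : Q 0 = (1 : Matrix (Fin (k + 1)) (Fin (k + 1)) ℂ) 0) :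
    ∃ V ∈ Matrix.unitaryGroup (Fin k) ℂ, Q = blockDiagOne V := by
  have hQ1 : Q * Qᴴ = 1 := Matrix.mem_unitaryGroup_iff.1 hQ
  -- Since row `0` of `Q` is `e₀`, column `0` of `Q * Qᴴ` is column `0` of `Q`.
  have hcol (i) : Q i 0 = (1 : Matrix (Fin (k + 1)) (Fin (k + 1)) ℂ) i 0 := by
    rw [← hQ1]
    simp [Matrix.mul_apply, h0, Matrix.one_apply]
  have h : Q = blockDiagOne (Q.submatrix Fin.succ Fin.succ) := by
    ext i j
    refine Fin.cases ?_ (fun i => ?_) i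
    · rw [h0]
      refine Fin.cases ?_ (fun j => ?_) j <;>
        simp [blockDiagOne, (Fin.succ_ne_zero _).symm]
    · refine Fin.cases ?_ (fun j => ?_) j
      · rw [hcol]
        simp [blockDiagOne, Fin.succ_ne_zero]
      · simp [blockDiagOne]
  refine ⟨_, ?_, h⟩
  rwa [← blockDiagOne_mem_unitaryGroup_iff, ← h]

lemma IsUnitaryCompletion.eq_map_C {u : Fin (k + 1) → ℂ[X]}
    {U : Matrix (Fin (k + 1)) (Fin (k + 1)) ℂ[X]} (h : IsUnitaryCompletion u 0 U) :
    ∃ U₀ ∈ Matrix.unitaryGroup (Fin (k + 1)) ℂ, U = U₀.map C := by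
  obtain ⟨h1, ⟨c, hc, hdet⟩, -⟩ := h
  have hU : U = (matCoeff U 0).map C := by
    ext1 i j
    exact eq_C_of_natDegree_le_zero (h1.natDegree_le hc hdet i j)
  refine ⟨_, ?_, hU⟩
  have := h1 1 (by simp)
  rw [hU, matEval_map_C] at this
  exact Matrix.mem_unitaryGroup_iff.2 this

/-- The coefficient in question is `u_N (1 - P) + a`; multiplied by `P` it becomes `a ≠ 0`. -/
lemma exists_coeff_elementaryQuotient_ne_zero {u : Fin (k + 1) → ℂ[X]} {N : ℕ}
    (ha : (fun j => (u j).coeff (N + 1)) ≠ 0) :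
    ∃ j, (elementaryQuotient (rowProjection fun j => (u j).coeff (N + 1))
      (Matrix.replicateRow Unit u) () j).coeff N ≠ 0 := by
  set a := fun j => (u j).coeff (N + 1) with ha_def
  by_contra! h
  have h1 : matCoeff (elementaryQuotient (rowProjection a) (Matrix.replicateRow Unit u)) N = 0 := by
    ext i j
    exact h j
  have h2 := congrArg (· * rowProjection a) h1
  simp only [matCoeff_elementaryQuotient, Matrix.add_mul, Matrix.mul_assoc, Matrix.sub_mul,
    rowProjection_mul_self ha, Matrix.one_mul, sub_self, Matrix.mul_zero, zero_add,
    Matrix.zero_mul] at h2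
  have h3 := congrFun h2 ()
  rw [Matrix.mul_apply_eq_vecMul] at h3
  exact ha ((vecMul_rowProjection_self ha).symm.trans h3)

lemma natDegree_elementaryQuotient_le {u : Fin (k + 1) → ℂ[X]} {N : ℕ}
    (hdeg : ∀ j, (u j).natDegree ≤ N + 1) (ha : (fun j => (u j).coeff (N + 1)) ≠ 0)
    (j : Fin (k + 1)) :
    (elementaryQuotient (rowProjection fun j => (u j).coeff (N + 1))
      (Matrix.replicateRow Unit u) () j).natDegree ≤ N := by
  set a := fun j => (u j).coeff (N + 1) with ha_def
  have hcoeff {n : ℕ} (hn : N + 1 < n) : matCoeff (Matrix.replicateRow Unit u) n = 0 := by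
    ext i j
    exact coeff_eq_zero_of_natDegree_lt ((hdeg j).trans_lt hn)
  have hlast : matCoeff (Matrix.replicateRow Unit u) (N + 1) * (1 - rowProjection a) = 0 := by
    rw [Matrix.mul_sub, Matrix.mul_one, sub_eq_zero]
    funext i
    rw [Matrix.mul_apply_eq_vecMul]
    exact (vecMul_rowProjection_self ha).symm
  refine natDegree_le_iff_coeff_eq_zero.2 fun n hn => ?_
  have h1 : matCoeff (elementaryQuotient (rowProjection a) (Matrix.replicateRow Unit u)) n = 0 := by
    rw [matCoeff_elementaryQuotient, hcoeff (by omega : N + 1 < n + 1), Matrix.zero_mul, add_zero]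
    obtain rfl | hn' := (Nat.succ_le_of_lt hn).eq_or_lt
    · exact hlast
    · rw [hcoeff hn', Matrix.zero_mul]
  exact congrFun (congrFun h1 ()) j

lemma IsUnitaryCompletion.exists_blockDiagOne {N : ℕ} {u : Fin (k + 1) → ℂ[X]}
    (hlead : ∃ j, (u j).coeff N ≠ 0)
    {U W : Matrix (Fin (k + 1)) (Fin (k + 1)) ℂ[X]} (hU : IsUnitaryCompletion u N U)
    (hW : IsUnitaryCompletion u N W) :
    ∃ V ∈ Matrix.unitaryGroup (Fin k) ℂ, W = (blockDiagOne V).map C * U := by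
  induction N generalizing u U W with
  | zero =>
    obtain ⟨U₀, hU₀, rfl⟩ := hU.eq_map_C
    obtain ⟨W₀, hW₀, rfl⟩ := hW.eq_map_C
    have hrow : W₀ 0 = U₀ 0 := by
      ext1 j
      exact C_injective (congrFun (hW.2.2.trans hU.2.2.symm) j)
    obtain ⟨V, hV, h⟩ := exists_eq_blockDiagOne (mul_mem hW₀ (Unitary.star_mem hU₀)) (by
      rw [Matrix.mul_apply_eq_vecMul, hrow, ← Matrix.mul_apply_eq_vecMul,
        Matrix.mem_unitaryGroup_iff.1 hU₀])
    refine ⟨V, hV, ?_⟩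
    rw [map_C_mul, ← h, Matrix.mul_assoc, Matrix.mem_unitaryGroup_iff'.1 hU₀, Matrix.mul_one]
  | succ N ih =>
    have ha : (fun j => (u j).coeff (N + 1)) ≠ 0 := Function.ne_iff.2 hlead
    obtain ⟨hUq, hU'⟩ := hU.elementaryQuotient ha
    obtain ⟨hWq, hW'⟩ := hW.elementaryQuotient ha
    obtain ⟨V, hV, h⟩ := ih (exists_coeff_elementaryQuotient_ne_zero ha) hU' hW'
    refine ⟨V, hV, ?_⟩
    rw [← hWq, h, Matrix.mul_assoc, hUq]

/-! ### Existence -/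

lemma isCircleIsometry_replicateRow_iff {n : Type*} [Fintype n] {u : n → ℂ[X]} :
    IsCircleIsometry (Matrix.replicateRow Unit u) ↔
      ∀ z : ℂ, ‖z‖ = 1 → ∑ j, ‖(u j).eval z‖ ^ 2 = 1 := by
  refine forall₂_congr fun z _ => ?_
  have h : (matEval (Matrix.replicateRow Unit u) z *
      (matEval (Matrix.replicateRow Unit u) z)ᴴ) () () =
        ((∑ j, ‖(u j).eval z‖ ^ 2 : ℝ) : ℂ) := by
    simp [Matrix.mul_apply, matEval, Complex.mul_conj, Complex.normSq_eq_norm_sq]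
  refine ⟨fun h1 => ?_, fun h1 => ?_⟩
  · rw [h1, Matrix.one_apply_eq] at h
    exact_mod_cast h.symm
  · ext i j
    rw [h, h1]
    simp

lemma exists_unitaryGroup_row_eq {v : Fin (k + 1) → ℂ} (hv : ∑ j, ‖v j‖ ^ 2 = 1) :
    ∃ Q ∈ Matrix.unitaryGroup (Fin (k + 1)) ℂ, Q 0 = v := by
  let w : EuclideanSpace ℂ (Fin (k + 1)) := WithLp.toLp 2 v
  have hw : ‖w‖ = 1 := by
    rw [EuclideanSpace.norm_eq, Real.sqrt_eq_one]
    exact hv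
  obtain ⟨b, hb⟩ := Orthonormal.exists_orthonormalBasis_extension_of_card_eq (𝕜 := ℂ)
    (E := EuclideanSpace ℂ (Fin (k + 1))) (ι := Fin (k + 1)) (by simp) (v := fun _ => w) (s := {0})
    ⟨fun i => by simpa using hw, fun i j hij => (hij (Subsingleton.elim i j)).elim⟩
  refine ⟨Matrix.of fun i j => b i j, Matrix.mem_unitaryGroup_iff.2 ?_, ?_⟩
  · ext i j
    have := orthonormal_iff_ite.1 b.orthonormal j i
    simp only [PiLp.inner_apply, RCLike.inner_apply] at this
    simpa [Matrix.mul_apply, Matrix.one_apply, eq_comm] using this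
  · ext1 j
    change b 0 j = v j
    rw [hb 0 rfl]

lemma norm_det_of_mem_unitaryGroup {n : Type*} [Fintype n] [DecidableEq n] {Q : Matrix n n ℂ}
    (hQ : Q ∈ Matrix.unitaryGroup n ℂ) : ‖Q.det‖ = 1 :=
  CStarRing.norm_of_mem_unitary (Matrix.det_of_mem_unitary hQ)

lemma isCircleIsometry_map_C {n : Type*} [Fintype n] [DecidableEq n] {Q : Matrix n n ℂ}
    (hQ : Q ∈ Matrix.unitaryGroup n ℂ) : IsCircleIsometry (Q.map C) := fun z _ => by
  rw [matEval_map_C]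
  exact Matrix.mem_unitaryGroup_iff.1 hQ

lemma det_map_C {n : Type*} [Fintype n] [DecidableEq n] (Q : Matrix n n ℂ) :
    (Q.map (C : ℂ → ℂ[X])).det = C Q.det :=
  ((C : ℂ →+* ℂ[X]).map_det Q).symm

lemma exists_isUnitaryCompletion {N : ℕ} {u : Fin (k + 1) → ℂ[X]}
    (hdeg : ∀ j, (u j).natDegree ≤ N) (hlead : ∃ j, (u j).coeff N ≠ 0)
    (hu : IsCircleIsometry (Matrix.replicateRow Unit u)) :
    ∃ U, IsUnitaryCompletion u N U := by
  induction N generalizing u with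
  | zero =>
    have hC (j) : u j = C ((u j).coeff 0) := eq_C_of_natDegree_le_zero (hdeg j)
    obtain ⟨Q, hQ, hrow⟩ := exists_unitaryGroup_row_eq (v := fun j => (u j).coeff 0) (by
      simpa [← coeff_zero_eq_eval_zero, fun j z => show (u j).eval z = (u j).coeff 0 by
        rw [hC j]; simp] using isCircleIsometry_replicateRow_iff.1 hu 1 (by simp))
    refine ⟨Q.map C, isCircleIsometry_map_C hQ,
      ⟨Q.det, norm_det_of_mem_unitaryGroup hQ, by simp [det_map_C]⟩, ?_⟩
    ext1 j
    rw [Matrix.map_apply, hrow, ← hC]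
  | succ N ih =>
    have ha : (fun j => (u j).coeff (N + 1)) ≠ 0 := Function.ne_iff.2 hlead
    have hP := rowProjection_mul_self ha
    -- The orthogonality needs no square matrix, so it applies to the single row `u`.
    have h0 : matCoeff (Matrix.replicateRow Unit u) 0 *
        rowProjection (fun j => (u j).coeff (N + 1)) = 0 := by
      refine mul_rowProjection_eq_zero _ fun i => ?_
      have := congrFun (congrFun (hu.matCoeff_zero_mul N.succ_ne_zero fun _ => hdeg) i) ()
      simpa [Matrix.mul_apply, matCoeff, dotProduct] using this
    have hq := elementaryQuotient_mul hP h0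
    have hu' : IsCircleIsometry (elementaryQuotient
        (rowProjection fun j => (u j).coeff (N + 1)) (Matrix.replicateRow Unit u)) := by
      rwa [← isCircleIsometry_mul_iff _
        (isCircleIsometry_elementaryFactor hP conjTranspose_rowProjection), hq]
    obtain ⟨U, hU⟩ := ih (natDegree_elementaryQuotient_le hdeg ha)
      (exists_coeff_elementaryQuotient_ne_zero ha) hu'
    refine ⟨_, hU.mul ha ?_⟩
    rw [← Matrix.mul_apply_eq_vecMul, hq]
    rfl

lemma IsUnitaryCompletion.blockDiagOne_mul {N : ℕ} {u : Fin (k + 1) → ℂ[X]}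
    {U : Matrix (Fin (k + 1)) (Fin (k + 1)) ℂ[X]} (h : IsUnitaryCompletion u N U)
    {V : Matrix (Fin k) (Fin k) ℂ} (hV : V ∈ Matrix.unitaryGroup (Fin k) ℂ) :
    IsUnitaryCompletion u N ((blockDiagOne V).map C * U) := by
  obtain ⟨h1, ⟨c, hc, hdet⟩, h3⟩ := h
  have hB := blockDiagOne_mem_unitaryGroup_iff.2 hV
  refine ⟨(isCircleIsometry_mul_iff _ h1).2 (isCircleIsometry_map_C hB),
    ⟨(blockDiagOne V).det * c, ?_, ?_⟩, ?_⟩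
  · rw [norm_mul, norm_det_of_mem_unitaryGroup hB, hc, one_mul]
  · rw [Matrix.det_mul, det_map_C, hdet, C_mul, mul_assoc]
  · ext1 j
    rw [← h3]
    simp [Matrix.mul_apply, Fin.sum_univ_succ, blockDiagOne]

end

theorem theorem2 (m : ℕ) (N : ℕ) (u : Fin (m + 1) → ℂ[X])
    (hdeg : ∀ j, (u j).natDegree ≤ N) (hlead : ∃ j, (u j).coeff N ≠ 0)
    (hnorm : ∀ z : ℂ, ‖z‖ = 1 → ∑ j, ‖(u j).eval z‖ ^ 2 = 1) :
    (∃ U : Matrix (Fin (m + 1)) (Fin (m + 1)) ℂ[X], IsParaunitaryCompletion u N U) ∧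
    ∀ U : Matrix (Fin (m + 1)) (Fin (m + 1)) ℂ[X], IsParaunitaryCompletion u N U →
      ∀ W : Matrix (Fin (m + 1)) (Fin (m + 1)) ℂ[X],
        IsParaunitaryCompletion u N W ↔
          ∃ V ∈ Matrix.unitaryGroup (Fin m) ℂ, W = (blockDiagOne V).map C * U := by
  refine ⟨?_, fun U hU W => ?_⟩
  · obtain ⟨U, hU⟩ := exists_isUnitaryCompletion hdeg hlead
      (isCircleIsometry_replicateRow_iff.2 hnorm)
    exact ⟨U, (isParaunitaryCompletion_iff hlead).2 hU⟩
  · rw [isParaunitaryCompletion_iff hlead] at hU ⊢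
    refine ⟨fun hW => hU.exists_blockDiagOne hlead hW, ?_⟩
    rintro ⟨V, hV, rfl⟩
    exact hU.blockDiagOne_mul hV
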